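/- Let $(X,d)$ be a nonempty proper geodesic metric space: closed balls are compact, and any two points $x,y\in X$ are joined by an isometric embedding $c:[a,b]\to X$ with $c(a)=x$, $c(b)=y$. Let $G$ be a discrete group with a free, isometric, properly discontinuous action $G\times X\to X$. Here free means that all point stabilizers are trivial, and properly discontinuous means that for all compact $K,L\subset X$ the set $\{g\in G: gK\cap L\neq\emptyset\}$ is finite. Then: 1. The action admits an open fundamental region, that is, an open subset $R\subset X$ such that (a) $\bigcup_{g\in G} g\overline{R}=X$; (b) for $g\in G$, $gR\cap R\neq\emptyset$ if and only if $g=1$; (c) for every compact $K\subset X$ the set $\{g\in G: g\overline{R}\cap K\neq\emptyset\}$ is finite. 2. The action admits a connected closed fundamental domain, that is, a connected closed subset $F\subset X$ which is the closure of its interior and satisfies (a) $\bigcup_{g\in G} gF=X$; (b) for $g\in G$, $g\operatorname{int}(F)\cap\operatorname{int}(F)\neq\emptyset$ if and only if $g=1$; (c) for every compact $K\subset X$ the set $\{g\in G: gF\cap K\neq\emptyset\}$ is finite. -/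

import Mathlib

open scoped Pointwise

/-- `X` is a geodesic metric space: any two points are joined by a geodesic segment, i.e. by an
isometric embedding of a compact interval. -/
def IsGeodesicMetricSpace (X : Type*) [MetricSpace X] : Prop :=
  ∀ x y : X, ∃ (a b : ℝ) (hab : a ≤ b) (c : Set.Icc a b → X),
    Isometry c ∧ c ⟨a, Set.left_mem_Icc.mpr hab⟩ = x ∧ c ⟨b, Set.right_mem_Icc.mpr hab⟩ = y

/-- The transporter set `(A | B)_G` of all `g` with `gA ∩ B ≠ ∅`. -/
def transporterSet (G : Type*) {X : Type*} [Group G] [MulAction G X] (A B : Set X) : Set G :=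
  {g : G | ((g • A) ∩ B).Nonempty}

/-- The orbit `G · A` of a subset `A`, i.e. the union of all its translates. -/
def setOrbit (G : Type*) {X : Type*} [Group G] [MulAction G X] (A : Set X) : Set X :=
  ⋃ g : G, g • A

/-- A closed domain (regular closed subset): it equals the closure of its interior. -/
def IsClosedDomain {X : Type*} [TopologicalSpace X] (V : Set X) : Prop :=
  closure (interior V) = V

/-- Open fundamental regions of a group action. -/
structure IsOpenFundamentalRegion (G : Type*) {X : Type*} [TopologicalSpace X] [Group G]
    [MulAction G X] (R : Set X) : Prop where
  isOpen : IsOpen R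
  orbit_closure : setOrbit G (closure R) = Set.univ
  meets_iff : ∀ g : G, ((g • R) ∩ R).Nonempty ↔ g = 1
  locally_finite : ∀ K : Set X, IsCompact K → (transporterSet G (closure R) K).Finite

/-- Closed fundamental domains of a group action. -/
structure IsClosedFundamentalDomain (G : Type*) {X : Type*} [TopologicalSpace X] [Group G]
    [MulAction G X] (F : Set X) : Prop where
  isClosed : IsClosed F
  isClosedDomain : IsClosedDomain F
  orbit : setOrbit G F = Set.univ
  meets_iff : ∀ g : G, ((g • interior F) ∩ interior F).Nonempty ↔ g = 1
  locally_finite : ∀ K : Set X, IsCompact K → (transporterSet G F K).Finite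

/-! Dirichlet domains fail here because bisectors in a geodesic space may have nonempty interior.
Instead, `X` is cut into additively weighted Voronoi cells whose centres are the orbits of countably
many points, with a `G`-invariant weight for each orbit. Weights avoid the countably many values for
which a bisector between different orbits is fat; within one orbit, small weights make ties
impossible at negative values. Baire then gives the cells dense union, and geodesics to the centres
make them connected. The cells form a locally finite family permuted freely by `G`. A Zorn argument
picks one cell per orbit so that the union of their closures is connected: this union is `F`, and
its interior serves as `R`. -/

/-! ### Assembling a fundamental domain from tiles -/

/-- In a locally finite equivariant closed cover of a connected space by connected tiles, one tile
of each type can be chosen so that the union of the chosen tiles is connected. -/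
theorem exists_isPreconnected_iUnion_selection {ι G X : Type*} [TopologicalSpace X]
    [PreconnectedSpace X] [Group G] [MulAction G X] [ContinuousConstSMul G X] [Nonempty ι]
    {P : ι × G → Set X} (hclosed : ∀ a, IsClosed (P a)) (hne : ∀ a, (P a).Nonempty)
    (hconn : ∀ a, IsPreconnected (P a)) (hcover : ⋃ a, P a = Set.univ)
    (hsmul : ∀ (g : G) (i : ι) (h : G), g • P (i, h) = P (i, g * h)) (hlf : LocallyFinite P) :
    ∃ k : ι → G, IsPreconnected (⋃ i, P (i, k i)) := by
  obtain ⟨i₀⟩ := ‹Nonempty ι›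
  obtain ⟨x₀, hx₀⟩ := hne (i₀, 1)
  obtain ⟨S, hS₀, hS⟩ := zorn_subset_nonempty
    {S : Set (ι × G) | Set.InjOn Prod.fst S ∧ (i₀, 1) ∈ S ∧ IsPreconnected (⋃ a ∈ S, P a)}
    (by
      intro c hc hchain ⟨T₀, hT₀⟩
      refine ⟨⋃₀ c, ⟨?_, ⟨T₀, hT₀, (hc hT₀).2.1⟩, ?_⟩, fun s hs => Set.subset_sUnion_of_mem hs⟩
      · rintro a ⟨s, hs, has⟩ b ⟨t, ht, hbt⟩ hab
        rcases hchain.total hs ht with h | h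
        · exact (hc ht).1 (h has) hbt hab
        · exact (hc hs).1 has (h hbt) hab
      · refine isPreconnected_of_forall x₀ ?_
        intro y hy
        simp only [Set.mem_iUnion] at hy
        obtain ⟨a, ⟨s, hs, has⟩, hya⟩ := hy
        refine ⟨⋃ a ∈ s, P a, Set.biUnion_subset_biUnion_left (Set.subset_sUnion_of_mem hs),
          Set.mem_biUnion (hc hs).2.1 hx₀, Set.mem_biUnion has hya, (hc hs).2.2⟩)
    {(i₀, 1)} ⟨Set.injOn_singleton _ _, rfl, by simpa using hconn _⟩
  obtain ⟨hinj, -, hpre⟩ := hS.prop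
  have hall : ∀ i, ∃ g, (i, g) ∈ S := by
    by_contra! hcon
    obtain ⟨j₀, hj₀⟩ := hcon
    -- Tiles of types already used and tiles of unused types form two closed sets covering the
    -- connected space, so they meet. Translating the meeting point onto a chosen tile lets `S`
    -- grow, against maximality.
    let A : Set (ι × G) := {a | ∃ g, (a.1, g) ∈ S}
    have hcl : ∀ B : Set (ι × G), IsClosed (⋃ a : B, P a) := fun B =>
      (hlf.comp_injective Subtype.val_injective).isClosed_iUnion fun a => hclosed a
    obtain ⟨p, -, hpA, hpB⟩ := isPreconnected_closed_iff.1 (isPreconnected_univ (α := X))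
      (⋃ a : A, P a) (⋃ a : ↥Aᶜ, P a) (hcl _) (hcl _)
      (by
        rw [← hcover]
        refine Set.iUnion_subset fun a => ?_
        by_cases ha : a ∈ A
        · exact (Set.subset_iUnion (fun a : A => P a) ⟨a, ha⟩).trans Set.subset_union_left
        · exact (Set.subset_iUnion (fun a : ↥Aᶜ => P a) ⟨a, ha⟩).trans Set.subset_union_right)
      ⟨x₀, trivial, Set.mem_iUnion.2 ⟨⟨(i₀, 1), 1, hS₀ rfl⟩, hx₀⟩⟩
      (by
        obtain ⟨y, hy⟩ := hne (j₀, 1)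
        exact ⟨y, trivial, Set.mem_iUnion.2 ⟨⟨(j₀, 1), fun ⟨g, hg⟩ => hj₀ g hg⟩, hy⟩⟩)
    obtain ⟨⟨⟨i, g⟩, g', hg'⟩, hpi⟩ := Set.mem_iUnion.1 hpA
    obtain ⟨⟨⟨j, h⟩, hj⟩, hpj⟩ := Set.mem_iUnion.1 hpB
    have hj' : ∀ g, (j, g) ∉ S := fun g hg => hj ⟨g, hg⟩
    have hqi : (g' * g⁻¹) • p ∈ P (i, g') := by
      have := Set.smul_mem_smul_set (a := g' * g⁻¹) hpi
      rwa [hsmul, inv_mul_cancel_right] at this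
    have hqj : (g' * g⁻¹) • p ∈ P (j, g' * g⁻¹ * h) := by
      have := Set.smul_mem_smul_set (a := g' * g⁻¹) hpj
      rwa [hsmul] at this
    refine hj' (g' * g⁻¹ * h) (hS.le_of_ge (y := insert (j, g' * g⁻¹ * h) S) ⟨?_, ?_, ?_⟩
      (Set.subset_insert _ _) (Set.mem_insert _ _))
    · refine (Set.injOn_insert (hj' _)).2 ⟨hinj, ?_⟩
      rintro ⟨⟨j', u⟩, hu, rfl⟩
      exact hj' _ hu
    · exact Set.mem_insert_of_mem _ (hS₀ rfl)
    · rw [Set.biUnion_insert]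
      exact IsPreconnected.union _ hqj (Set.mem_biUnion hg' hqi) (hconn _) hpre
  choose k hk using hall
  refine ⟨k, ?_⟩
  convert hpre using 1
  apply Set.Subset.antisymm
  · exact Set.iUnion_subset fun i => Set.subset_biUnion_of_mem (u := P) (hk i)
  · refine Set.iUnion₂_subset fun a ha => ?_
    have : (a.1, k a.1) = a := hinj (hk _) ha rfl
    rw [← this]
    exact Set.subset_iUnion (fun i => P (i, k i)) a.1

/-- If `R` is open, then translates of `interior (closure R)` are disjoint as soon as the
corresponding translates of `R` are. -/
theorem disjoint_smul_interior_closure {G X : Type*} [TopologicalSpace X] [Group G] [MulAction G X]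
    [ContinuousConstSMul G X] {R : Set X} (hR : IsOpen R) {g : G} (h : Disjoint (g • R) R) :
    Disjoint (g • interior (closure R)) (interior (closure R)) := by
  have h1 : Disjoint (g • R) (closure R) := h.closure_right (hR.smul g)
  have h2 : Disjoint (closure (g • R)) (interior (closure R)) :=
    (h1.mono_right interior_subset).closure_left isOpen_interior
  rw [closure_smul] at h2
  exact h2.mono_left (Set.smul_set_mono interior_subset)

/-- A locally finite equivariant family of disjoint connected open tiles with dense union yields
a connected closed fundamental domain. -/
theorem exists_isClosedFundamentalDomain_of_tiles {ι G X : Type*} [TopologicalSpace X] [Nonempty X]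
    [PreconnectedSpace X] [Group G] [MulAction G X] [ContinuousConstSMul G X]
    {R : ι × G → Set X} (hopen : ∀ a, IsOpen (R a)) (hconn : ∀ a, IsPreconnected (R a))
    (hdisj : ∀ a b, a ≠ b → Disjoint (R a) (R b)) (hdense : Dense (⋃ a, R a))
    (hsmul : ∀ (g : G) (i : ι) (h : G), g • R (i, h) = R (i, g * h)) (hlf : LocallyFinite R) :
    ∃ F : Set X, IsClosedFundamentalDomain G F ∧ IsConnected F := by
  -- Cells may be empty, and whether one is depends only on its type; empty types are discarded.
  let J := {i : ι // (R (i, 1)).Nonempty}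
  let Q : J × G → Set X := fun a => R (a.1, a.2)
  have hval : Function.Injective fun a : J × G => ((a.1 : ι), a.2) := by
    rintro ⟨i, g⟩ ⟨j, h⟩ hab
    exact Prod.ext (Subtype.ext (Prod.ext_iff.1 hab).1) (Prod.ext_iff.1 hab).2
  have hQne : ∀ a, (Q a).Nonempty := by
    rintro ⟨⟨i, hi⟩, g⟩
    have := hsmul g i 1
    rw [mul_one] at this
    change (R (i, g)).Nonempty
    rw [← this]
    exact hi.smul_set
  have hQlf : LocallyFinite Q := hlf.comp_injective hval
  have hQdense : Dense (⋃ a, Q a) := by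
    refine hdense.mono (Set.iUnion_subset ?_)
    rintro ⟨i, g⟩ x hx
    have hi : (R (i, 1)).Nonempty := by
      have := hsmul g⁻¹ i g
      rw [inv_mul_cancel] at this
      rw [← this]
      exact ⟨_, Set.smul_mem_smul_set hx⟩
    exact Set.mem_iUnion.2 ⟨(⟨i, hi⟩, g), hx⟩
  have hJ : Nonempty J := by
    obtain ⟨x, hx⟩ := hQdense.nonempty
    obtain ⟨a, -⟩ := Set.mem_iUnion.1 hx
    exact ⟨a.1⟩
  have hPsmul : ∀ (g : G) (i : J) (h : G), g • closure (Q (i, h)) = closure (Q (i, g * h)) := by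
    intro g i h
    rw [← closure_smul]
    exact congrArg closure (hsmul g i h)
  have hcover : ⋃ a, closure (Q a) = Set.univ := by
    rw [← hQlf.closure_iUnion, hQdense.closure_eq]
  obtain ⟨k, hk⟩ := exists_isPreconnected_iUnion_selection (P := fun a => closure (Q a))
    (fun _ => isClosed_closure) (fun a => (hQne a).closure) (fun a => (hconn _).closure)
    hcover hPsmul hQlf.closure
  have hkinj : Function.Injective fun i : J => (i, k i) := fun i j h => (Prod.ext_iff.1 h).1
  have hF : closure (⋃ i, Q (i, k i)) = ⋃ i, closure (Q (i, k i)) :=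
    (hQlf.comp_injective hkinj).closure_iUnion
  have hUopen : IsOpen (⋃ i, Q (i, k i)) := isOpen_iUnion fun i => hopen _
  set U := ⋃ i, Q (i, k i) with hU
  have hUne : U.Nonempty := by
    obtain ⟨x, hx⟩ := hQne (hJ.some, k hJ.some)
    exact ⟨x, Set.mem_iUnion.2 ⟨_, hx⟩⟩
  refine ⟨closure U, ⟨isClosed_closure, ?_, ?_, ?_, ?_⟩, hUne.closure, hF ▸ hk⟩
  · exact (closure_minimal interior_subset isClosed_closure).antisymm
      (closure_mono (interior_maximal subset_closure hUopen))
  · refine Set.eq_univ_of_univ_subset ?_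
    rw [← hcover]
    refine Set.iUnion_subset ?_
    rintro ⟨i, g⟩
    refine Set.Subset.trans ?_ (Set.subset_iUnion _ (g * (k i)⁻¹))
    have := hPsmul (g * (k i)⁻¹) i (k i)
    rw [inv_mul_cancel_right] at this
    rw [← this, hF]
    exact Set.smul_set_mono (Set.subset_iUnion (fun i => closure (Q (i, k i))) i)
  · intro g
    constructor
    · intro hg
      by_contra hg1
      refine Set.not_disjoint_iff_nonempty_inter.2 hg (disjoint_smul_interior_closure hUopen ?_)
      rw [hU, Set.smul_set_iUnion, Set.disjoint_iUnion_left]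
      intro i
      rw [Set.disjoint_iUnion_right]
      intro j
      change Disjoint (g • R (i, k i)) (R (j, k j))
      rw [hsmul]
      refine hdisj _ _ fun hij => hg1 ?_
      obtain ⟨h1, h2⟩ := Prod.ext_iff.1 hij
      have h1' : i = j := Subtype.ext h1
      subst h1'
      simpa using h2
    · rintro rfl
      rw [one_smul, Set.inter_self]
      exact hUne.mono (interior_maximal subset_closure hUopen)
  · intro K hK
    refine ((hQlf.closure.finite_nonempty_inter_compact hK).image
      fun a : J × G => a.2 * (k a.1)⁻¹).subset ?_
    rintro g ⟨x, hxg, hxK⟩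
    rw [hF, Set.smul_set_iUnion] at hxg
    obtain ⟨i, hi⟩ := Set.mem_iUnion.1 hxg
    rw [hPsmul] at hi
    exact ⟨(i, g * k i), ⟨x, hi, hxK⟩, by simp⟩

/-- The interior of a nonempty closed fundamental domain is an open fundamental region. -/
theorem IsClosedFundamentalDomain.isOpenFundamentalRegion_interior {G X : Type*}
    [TopologicalSpace X] [Group G] [MulAction G X] {F : Set X}
    (hF : IsClosedFundamentalDomain G F) : IsOpenFundamentalRegion G (interior F) where
  isOpen := isOpen_interior
  orbit_closure := by rw [hF.isClosedDomain]; exact hF.orbit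
  meets_iff := hF.meets_iff
  locally_finite := by rw [hF.isClosedDomain]; exact hF.locally_finite

/-! ### Geodesics and generic weights -/

/-- Any two points of a geodesic space lie in a connected set of points between them. -/
theorem IsGeodesicMetricSpace.exists_isPreconnected_between {X : Type*} [MetricSpace X]
    (hX : IsGeodesicMetricSpace X) (x y : X) :
    ∃ s : Set X, IsPreconnected s ∧ x ∈ s ∧ y ∈ s ∧ ∀ z ∈ s, dist x z + dist z y = dist x y := by
  obtain ⟨a, b, hab, c, hc, rfl, rfl⟩ := hX x y
  have : PreconnectedSpace (Set.Icc a b) := Subtype.preconnectedSpace isPreconnected_Icc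
  refine ⟨Set.range c, isPreconnected_range hc.continuous, ⟨_, rfl⟩, ⟨_, rfl⟩, ?_⟩
  rintro _ ⟨⟨t, ht⟩, rfl⟩
  rw [hc.dist_eq, hc.dist_eq, hc.dist_eq, Subtype.dist_eq, Subtype.dist_eq, Subtype.dist_eq,
    Real.dist_eq, Real.dist_eq, Real.dist_eq, abs_of_nonpos (by linarith [ht.1]),
    abs_of_nonpos (by linarith [ht.2]), abs_of_nonpos (by linarith)]
  ring

theorem IsGeodesicMetricSpace.preconnectedSpace {X : Type*} [MetricSpace X]
    (hX : IsGeodesicMetricSpace X) : PreconnectedSpace X :=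
  ⟨isPreconnected_of_forall_pair fun x _ y _ =>
    let ⟨s, hs, hx, hy, _⟩ := hX.exists_isPreconnected_between x y
    ⟨s, Set.subset_univ s, hx, hy, hs⟩⟩

/-- Real numbers can be chosen in given intervals so that their pairwise differences avoid given
countable sets. -/
theorem exists_sub_notMem_of_countable {ι : Type*} [Countable ι] {a b : ι → ℝ}
    (hab : ∀ i, a i < b i) {B : ι → ι → Set ℝ} (hB : ∀ i j, (B i j).Countable) :
    ∃ w : ι → ℝ, (∀ i, w i ∈ Set.Ioo (a i) (b i)) ∧ ∀ i j, i ≠ j → w i - w j ∉ B i j := by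
  obtain ⟨e, he⟩ := Countable.exists_injective_nat ι
  have key : ∀ (i : ι) (f : ∀ j, e j < e i → ℝ), ∃ w ∈ Set.Ioo (a i) (b i),
      ∀ j (h : e j < e i), w - f j h ∉ B i j ∧ f j h - w ∉ B j i := by
    intro i f
    -- Values excluded by earlier indices, for both orders of the difference.
    let T : Set ℝ := ⋃ j : {j // e j < e i},
      ((fun t => t + f j j.2) '' B i j) ∪ ((fun t => f j j.2 - t) '' B j i)
    have hT : T.Countable := Set.countable_iUnion fun j =>
      ((hB _ _).image _).union ((hB _ _).image _)
    obtain ⟨w, hwT, hw⟩ := (hT.dense_compl ℝ).exists_mem_open isOpen_Ioo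
      (Set.nonempty_Ioo.2 (hab i))
    refine ⟨w, hw, fun j h => ⟨fun hm => hwT ?_, fun hm => hwT ?_⟩⟩
    · exact Set.mem_iUnion.2 ⟨⟨j, h⟩, Or.inl ⟨_, hm, by simp⟩⟩
    · exact Set.mem_iUnion.2 ⟨⟨j, h⟩, Or.inr ⟨_, hm, by simp⟩⟩
  choose W hW hW' using key
  let w : ι → ℝ := (measure e).wf.fix W
  have hw : ∀ i, w i = W i fun j _ => w j := fun i => (measure e).wf.fix_eq W i
  refine ⟨w, fun i => hw i ▸ hW i _, fun i j hij => ?_⟩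
  rcases (he.ne hij).lt_or_gt with h | h
  · have := (hW' j (fun j _ => w j) i h).2
    rwa [← hw] at this
  · have := (hW' i (fun j _ => w j) j h).1
    rwa [← hw] at this

/-- All but countably many level sets of a continuous function on a separable space have empty
interior. -/
theorem countable_setOf_nonempty_interior_preimage {X Y : Type*} [TopologicalSpace X]
    [TopologicalSpace.SeparableSpace X] (f : X → Y) :
    {c | (interior (f ⁻¹' {c})).Nonempty}.Countable := by
  refine Set.PairwiseDisjoint.countable_of_isOpen (s := fun c => interior (f ⁻¹' {c})) ?_
    (fun _ _ => isOpen_interior) fun _ h => h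
  intro c _ d _ hcd
  exact ((Set.disjoint_singleton.2 hcd).preimage f).mono interior_subset interior_subset

/-! ### Orbits and a locally finite cover by balls -/

section Action

variable {X G : Type*} [MetricSpace X] [ProperSpace X] [Group G] [MulAction G X]
  [ProperlyDiscontinuousSMul G X]

/-- Only finitely many points of an orbit, counted with multiplicity, lie in a given ball. -/
theorem finite_setOf_dist_smul_le (p q : X) (r : ℝ) : {g : G | dist (g • p) q ≤ r}.Finite := by
  refine (ProperlyDiscontinuousSMul.finite_disjoint_inter_image (Γ := G)
    (isCompact_singleton (x := p)) (isCompact_closedBall q r)).subset fun g hg => ?_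
  exact ⟨g • p, ⟨p, rfl, rfl⟩, hg⟩

/-- A group acting properly discontinuously on a nonempty proper space is countable. -/
theorem countable_of_properlyDiscontinuousSMul (X G : Type*) [MetricSpace X] [ProperSpace X]
    [Nonempty X] [Group G] [MulAction G X] [ProperlyDiscontinuousSMul G X] : Countable G := by
  obtain ⟨x⟩ := ‹Nonempty X›
  have h : (⋃ n : ℕ, {g : G | dist (g • x) x ≤ n}).Countable :=
    Set.countable_iUnion fun n => (finite_setOf_dist_smul_le x x n).countable
  rw [← Set.countable_univ_iff]
  refine h.mono fun g _ => ?_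
  exact Set.mem_iUnion.2 (exists_nat_ge (dist (g • x) x))

/-- Under a free action every point is moved by a definite amount by all nontrivial elements. -/
theorem exists_pos_forall_le_dist_smul (hfree : ∀ x : X, MulAction.stabilizer G x = ⊥) (x : X) :
    ∃ r : ℝ, 0 < r ∧ r ≤ 1 ∧ ∀ g : G, g ≠ 1 → 2 * r ≤ dist x (g • x) := by
  have hfin : {g : G | dist (g • x) x ≤ 2 ∧ g ≠ 1}.Finite :=
    (finite_setOf_dist_smul_le x x 2).subset fun g hg => hg.1
  rcases Set.eq_empty_or_nonempty {g : G | dist (g • x) x ≤ 2 ∧ g ≠ 1} with h | h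
  · refine ⟨1, one_pos, le_rfl, fun g hg => ?_⟩
    by_contra hlt
    rw [Set.eq_empty_iff_forall_notMem] at h
    exact h g ⟨by rw [dist_comm]; linarith, hg⟩
  · obtain ⟨g₀, hg₀, hmin⟩ := Set.exists_min_image _ (fun g : G => dist (g • x) x) hfin h
    have hpos : 0 < dist (g₀ • x) x := by
      refine dist_pos.2 fun heq => hg₀.2 ?_
      have : g₀ ∈ MulAction.stabilizer G x := heq
      rwa [hfree, Subgroup.mem_bot] at this
    refine ⟨dist (g₀ • x) x / 2, by linarith, by linarith [hg₀.1], fun g hg => ?_⟩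
    rw [dist_comm x (g • x)]
    by_cases h2 : dist (g • x) x ≤ 2
    · linarith [hmin g ⟨h2, hg⟩]
    · linarith [hg₀.1]

/-- A locally finite cover by countably many orbits of small balls. -/
theorem exists_locallyFinite_smul_ball_cover [Nonempty X] [IsIsometricSMul G X]
    (hfree : ∀ x : X, MulAction.stabilizer G x = ⊥) :
    ∃ (s : Set (ℕ × X)) (a b : s → ℝ), s.Countable ∧ (∀ i, a i < b i) ∧
      (∀ i (g : G), g ≠ 1 → 2 * b i ≤ dist (i : ℕ × X).2 (g • (i : ℕ × X).2)) ∧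
      (∀ x, ∃ (i : s) (g : G), dist x (g • (i : ℕ × X).2) < a i) ∧
      LocallyFinite fun q : s × G => Metric.closedBall (q.2 • (q.1 : ℕ × X).2) (b q.1) := by
  obtain ⟨x₀⟩ := ‹Nonempty X›
  choose r hr0 hr1 hr using exists_pos_forall_le_dist_smul (G := G) hfree
  -- Compact shells around `x₀`. A point whose nearest orbit point is `x₀` lies in one of them; the
  -- lower bound keeps all translates of the `n`-th shell away from `x₀`, which yields local
  -- finiteness.
  let L : ℕ → Set X := fun n =>
    Metric.closedBall x₀ (n + 1) ∩ ⋂ g : G, {x | (n : ℝ) ≤ dist x (g • x₀)}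
  have hL : ∀ n, IsCompact (L n) := fun n => (isCompact_closedBall _ _).inter_right
    (isClosed_iInter fun g => isClosed_le continuous_const (continuous_id.dist continuous_const))
  -- Half-radius balls already cover, leaving the interval from `r p / 2` to `r p` free for the
  -- weight.
  have hsub := fun n => (hL n).elim_nhds_subcover (fun p => Metric.ball p (r p / 2))
    fun p _ => Metric.ball_mem_nhds _ (half_pos (hr0 p))
  choose t htL htc using hsub
  let s : Set (ℕ × X) := ⋃ n, Prod.mk n '' (t n : Set X)
  have hs : ∀ i : s, (i : ℕ × X).2 ∈ t (i : ℕ × X).1 := by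
    rintro ⟨⟨n, p⟩, hi⟩
    obtain ⟨m, q, hq, h⟩ := Set.mem_iUnion.1 hi
    obtain ⟨rfl, rfl⟩ := Prod.mk.inj h
    exact hq
  refine ⟨s, fun i => r (i : ℕ × X).2 / 2, fun i => r (i : ℕ × X).2,
    Set.countable_iUnion fun n => ((t n).countable_toSet.image _),
    fun i => by linarith [hr0 (i : ℕ × X).2], fun i => hr _, ?_, ?_⟩
  · intro x
    obtain ⟨g₀, -, hmin⟩ := Set.exists_min_image {g : G | dist (g • x₀) x ≤ dist x₀ x}
      (fun g : G => dist (g • x₀) x) (finite_setOf_dist_smul_le _ _ _) ⟨1, by simp⟩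
    have hmin' : ∀ g : G, dist (g₀ • x₀) x ≤ dist (g • x₀) x := by
      intro g
      by_cases hg : dist (g • x₀) x ≤ dist x₀ x
      · exact hmin g hg
      · have := hmin 1 (by simp)
        rw [one_smul] at this
        linarith
    let n := ⌊dist (g₀ • x₀) x⌋₊
    have hmem : g₀⁻¹ • x ∈ L n := by
      refine ⟨?_, Set.mem_iInter.2 fun g => ?_⟩
      · rw [Metric.mem_closedBall, ← dist_smul g₀, smul_inv_smul, dist_comm]
        exact (Nat.lt_floor_add_one _).le
      · rw [Set.mem_ofPred_eq, ← dist_smul g₀, smul_inv_smul, dist_comm, smul_smul]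
        exact (Nat.floor_le dist_nonneg).trans (hmin' _)
    obtain ⟨p, hp, hxp⟩ := Set.mem_iUnion₂.1 (htc n hmem)
    refine ⟨⟨(n, p), Set.mem_iUnion.2 ⟨n, p, hp, rfl⟩⟩, g₀, ?_⟩
    rw [Metric.mem_ball, ← dist_smul g₀, smul_inv_smul] at hxp
    exact hxp
  · intro x
    refine ⟨Metric.closedBall x 1, Metric.closedBall_mem_nhds x one_pos, ?_⟩
    -- One unit for the neighbourhood of `x`, one for the ball radius `r p ≤ 1`.
    obtain ⟨M, hM⟩ := exists_nat_ge (dist x x₀ + 2)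
    have hfin : (⋃ n ∈ Set.Iic M, ⋃ p ∈ (t n : Set X),
        (fun g : G => ((n, p), g)) '' {g : G | dist (g • p) x₀ ≤ M}).Finite :=
      (Set.finite_Iic M).biUnion fun n _ => (t n).finite_toSet.biUnion fun p _ =>
        (finite_setOf_dist_smul_le _ _ _).image _
    refine Set.Finite.subset (hfin.preimage (f := fun q : s × G => ((q.1 : ℕ × X), q.2)) ?_) ?_
    · rintro ⟨i, g⟩ - ⟨j, h⟩ - hab
      exact Prod.ext (Subtype.ext (Prod.ext_iff.1 hab).1) (Prod.ext_iff.1 hab).2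
    · rintro ⟨i, g⟩ ⟨z, hz1, hz2⟩
      have hi := hs i
      obtain ⟨⟨n, p⟩, hnp⟩ := i
      simp only [Metric.mem_closedBall] at hz1 hz2 hi
      have hd : dist (g • p) x₀ ≤ M := by
        have h1 := dist_triangle (g • p) z x₀
        have h2 := dist_triangle z x x₀
        have h3 := hr1 p
        rw [dist_comm (g • p) z] at h1
        linarith
      have hn : (n : ℝ) ≤ M := by
        have := Set.mem_iInter.1 (htL n p hi).2 g⁻¹
        rw [Set.mem_ofPred_eq, ← dist_smul g, smul_inv_smul] at this
        exact this.trans hd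
      refine Set.mem_iUnion₂.2 ⟨n, by exact_mod_cast hn, Set.mem_iUnion₂.2 ⟨p, hi, g, hd, rfl⟩⟩

end Action

/-! ### Weighted Voronoi cells -/

/-- The cell of `k` for a family of functions: the points where `f k` is the strict minimum. -/
def strictMinCell {κ X : Type*} (f : κ → X → ℝ) (k : κ) : Set X :=
  {x | f k x < 0 ∧ ∀ l, l ≠ k → f k x < f l x}

theorem disjoint_strictMinCell {κ X : Type*} (f : κ → X → ℝ) {k l : κ} (h : k ≠ l) :
    Disjoint (strictMinCell f k) (strictMinCell f l) :=
  Set.disjoint_left.2 fun _ hk hl => lt_asymm (hk.2 l h.symm) (hl.2 k h)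

/-- Near a given point only finitely many functions are ever nonpositive; all others exceed the
negative `f k` automatically. -/
theorem isOpen_strictMinCell {κ X : Type*} [TopologicalSpace X] {f : κ → X → ℝ}
    (hf : ∀ k, Continuous (f k)) (hlf : LocallyFinite fun k => {x | f k x ≤ 0}) (k : κ) :
    IsOpen (strictMinCell f k) := by
  rw [isOpen_iff_mem_nhds]
  intro x hx
  obtain ⟨U, hU, hfin⟩ := hlf x
  have h1 : ∀ᶠ y in nhds x, f k y < 0 := (hf k).continuousAt.eventually_lt_const hx.1
  have h2 : ∀ᶠ y in nhds x, ∀ l ∈ {l | ({x | f l x ≤ 0} ∩ U).Nonempty}, l ≠ k → f k y < f l y :=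
    (Filter.eventually_all_finite hfin).2 fun l _ => by
      by_cases hl : l = k
      · simp [hl]
      · exact ((hf k).continuousAt.eventually_lt (hf l).continuousAt (hx.2 l hl)).mono
          fun y hy _ => hy
  filter_upwards [h1, h2, hU] with y hy1 hy2 hyU
  refine ⟨hy1, fun l hl => ?_⟩
  by_cases hly : f l y ≤ 0
  · exact hy2 l ⟨y, hly, hyU⟩ hl
  · exact hy1.trans (not_le.1 hly)

/-- If the negative sets cover and ties at negative values only occur along sets with empty
interior, then the cells of strict minima have dense union. -/
theorem dense_iUnion_strictMinCell {κ X : Type*} [TopologicalSpace X] [BaireSpace X] [Countable κ]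
    {f : κ → X → ℝ} (hf : ∀ k, Continuous (f k)) (hlf : LocallyFinite fun k => {x | f k x ≤ 0})
    (hcover : ∀ x, ∃ k, f k x < 0)
    (htie : ∀ k l, k ≠ l → (∀ x, f k x < 0 → f k x ≠ f l x) ∨ interior {x | f k x = f l x} = ∅) :
    Dense (⋃ k, strictMinCell f k) := by
  let T := {q : κ × κ // interior {x | f q.1 x = f q.2 x} = ∅}
  have hD : Dense (⋂ q : T, {x | f q.1.1 x = f q.1.2 x}ᶜ) :=
    dense_iInter_of_isOpen (fun q => (isClosed_eq (hf _) (hf _)).isOpen_compl)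
      fun q => interior_eq_empty_iff_dense_compl.1 q.2
  refine hD.mono fun x hx => ?_
  obtain ⟨k₀, hk₀⟩ := hcover x
  obtain ⟨k, hk, hmin⟩ := Set.exists_min_image {k | f k x ≤ 0} (fun k => f k x)
    (hlf.point_finite x) ⟨k₀, hk₀.le⟩
  have hneg : f k x < 0 := (hmin k₀ hk₀.le).trans_lt hk₀
  refine Set.mem_iUnion.2 ⟨k, hneg, fun l hl => ?_⟩
  have hle : f k x ≤ f l x := by
    by_cases hlx : f l x ≤ 0
    · exact hmin l hlx
    · exact hneg.le.trans (not_le.1 hlx).le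
  refine hle.lt_of_ne ?_
  rcases htie k l hl.symm with h | h
  · exact h x hneg
  · exact Set.mem_iInter.1 hx ⟨(k, l), h⟩

/-- Additively weighted Voronoi cells in a geodesic space are connected. -/
theorem IsGeodesicMetricSpace.isPreconnected_strictMinCell {κ X : Type*} [MetricSpace X]
    (hX : IsGeodesicMetricSpace X) (p : κ → X) (w : κ → ℝ) (k : κ) :
    IsPreconnected (strictMinCell (fun k x => dist x (p k) - w k) k) := by
  refine isPreconnected_of_forall (p k) fun x hx => ?_
  obtain ⟨s, hs, hxs, hps, hbetween⟩ := hX.exists_isPreconnected_between x (p k)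
  -- Moving from `x` to `z` lowers the distance to `p k` by exactly `dist x z`, and any other
  -- distance by at most that.
  refine ⟨s, fun z hz => ⟨?_, fun l hl => ?_⟩, hps, hxs, hs⟩
  · have h1 : dist x (p k) - w k < 0 := hx.1
    have := hbetween z hz
    have h2 := dist_nonneg (x := x) (y := z)
    change dist z (p k) - w k < 0
    linarith
  · have h1 : dist x (p k) - w k < dist x (p l) - w l := hx.2 l hl
    have := hbetween z hz
    have h2 := dist_triangle x z (p l)
    change dist z (p k) - w k < dist z (p l) - w l
    linarith

/-! ### Conclusion -/

theorem mainTheorem1 {X G : Type*} [MetricSpace X] [ProperSpace X] [Nonempty X]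
    (hX : IsGeodesicMetricSpace X)
    [Group G] [MulAction G X] [IsIsometricSMul G X] [ProperlyDiscontinuousSMul G X]
    (hfree : ∀ x : X, MulAction.stabilizer G x = ⊥) :
    (∃ R : Set X, IsOpenFundamentalRegion G R) ∧
      (∃ F : Set X, IsClosedFundamentalDomain G F ∧ IsConnected F) := by
  have := hX.preconnectedSpace
  have := countable_of_properlyDiscontinuousSMul X G
  obtain ⟨s, a, b, hs, hab, hsep, hcover, hlf⟩ :=
    exists_locallyFinite_smul_ball_cover (G := G) hfree
  have := hs.to_subtype
  let p : s → X := fun i => (i : ℕ × X).2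
  -- Weight differences that would give some bisector between the two orbits nonempty interior.
  let B : s → s → Set ℝ := fun i j => ⋃ q : G × G,
    {c | (interior ((fun x => dist x (q.1 • p i) - dist x (q.2 • p j)) ⁻¹' {c})).Nonempty}
  obtain ⟨w, hw, hwB⟩ := exists_sub_notMem_of_countable hab (B := B)
    fun i j => Set.countable_iUnion fun q => countable_setOf_nonempty_interior_preimage _
  let f : s × G → X → ℝ := fun q x => dist x (q.2 • p q.1) - w q.1
  have hf : ∀ q, Continuous (f q) := fun q =>
    (continuous_id.dist continuous_const).sub continuous_const
  have hflf : LocallyFinite fun q => {x | f q x ≤ 0} := hlf.subset fun q x hx => by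
    have h1 : dist x (q.2 • p q.1) - w q.1 ≤ 0 := hx
    have h2 := (hw q.1).2
    rw [Metric.mem_closedBall]
    linarith
  have hdense : Dense (⋃ q, strictMinCell f q) := by
    refine dense_iUnion_strictMinCell hf hflf ?_ ?_
    · intro x
      obtain ⟨i, g, hx⟩ := hcover x
      exact ⟨(i, g), sub_neg.2 (hx.trans (hw i).1)⟩
    · rintro ⟨i, g⟩ ⟨j, h⟩ hne
      by_cases hij : i = j
      · subst hij
        -- A negative tie would put two distinct points of one orbit within `w i < b i` of `x`,
        -- closer together than `hsep` allows.
        refine Or.inl fun x hx heq => ?_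
        have hgh : g⁻¹ * h ≠ 1 := fun h1 => hne (by rw [inv_mul_eq_one.1 h1])
        have h1 := hsep i _ hgh
        rw [← dist_smul g, smul_smul, mul_inv_cancel_left] at h1
        have h2 := dist_triangle_left (g • p i) (h • p i) x
        have h3 := (hw i).2
        simp only [f] at hx heq
        linarith
      · right
        by_contra hint
        refine hwB i j hij (Set.mem_iUnion.2 ⟨(g, h), ?_⟩)
        rw [← ne_eq, ← Set.nonempty_iff_ne_empty] at hint
        refine hint.mono (interior_mono fun x hx => ?_)
        have hx' : dist x (g • p i) - w i = dist x (h • p j) - w j := hx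
        change dist x (g • p i) - dist x (h • p j) = w i - w j
        linarith
  have hsmul : ∀ (g : G) (i : s) (h : G),
      g • strictMinCell f (i, h) = strictMinCell f (i, g * h) := by
    have hfg : ∀ (g : G) (i : s) (h : G) (x : X), f (i, g * h) x = f (i, h) (g⁻¹ • x) := by
      intro g i h x
      simp only [f]
      rw [← dist_smul g (g⁻¹ • x), smul_inv_smul, mul_smul]
    intro g i h
    ext x
    rw [Set.mem_smul_set_iff_inv_smul_mem]
    simp only [strictMinCell, Set.mem_ofPred_eq, hfg]
    refine and_congr_right fun _ => ⟨?_, ?_⟩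
    · rintro hx ⟨j, u⟩ hne
      have := hx (j, g⁻¹ * u) fun heq => hne (by
        obtain ⟨rfl, rfl⟩ := Prod.mk.inj heq
        rw [mul_inv_cancel_left])
      rwa [← hfg g j, mul_inv_cancel_left] at this
    · rintro hx ⟨j, u⟩ hne
      have := hx (j, g * u) fun heq => hne (by
        obtain ⟨rfl, h2⟩ := Prod.mk.inj heq
        rw [mul_left_cancel h2])
      rwa [hfg] at this
  obtain ⟨F, hF, hFconn⟩ := exists_isClosedFundamentalDomain_of_tiles
    (isOpen_strictMinCell hf hflf)
    (hX.isPreconnected_strictMinCell (fun q : s × G => q.2 • p q.1) fun q => w q.1)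
    (fun _ _ h => disjoint_strictMinCell f h) hdense hsmul
    (hflf.subset fun q x hx => hx.1.le)
  exact ⟨⟨_, hF.isOpenFundamentalRegion_interior⟩, F, hF, hFconn⟩
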